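/- Let $\mathbb{R}^{\mathbb{N}}$ be the vector lattice of all real sequences with the componentwise order, and let $e^i$ denote its $i$-th unit vector. Call a linear subspace $E\subseteq\mathbb{R}^{\mathbb{N}}$ a *sequence space* if it is closed under the componentwise lattice operations $\vee,\wedge$ and contains every $e^i$, $i\in\mathbb{N}$. A sequence $(x^k)_k$ in $E$ is *order convergent* to $x\in E$ if there are $a,b\in E$ with $a\le x^k\le b$ for all $k$, and $x^k_n\to x_n$ as $k\to\infty$ for every $n\in\mathbb{N}$. A norm on $E$ is a *lattice norm* if $|x|\le|y|$ implies $\|x\|\le\|y\|$, and a lattice norm is *order continuous* if every sequence in $E$ that is order convergent to some $x\in E$ converges to $x$ in norm. Let $E$ be a sequence space with a complete and order continuous lattice norm (for example $c_0$, or $\ell^p$ with $1\le p<\infty$). Let $(T_t)_{t\in(0,\infty)}$ be a positive semigroup on $E$, i.e. a family of linear operators $T_t\colon E\to E$ with $T_{t+s}=T_tT_s$ for all $t,s>0$, such that $T_tx\ge 0$ for all $t>0$ and all $x\in E$ with $x\ge 0$. Suppose that for all $i,j\in\mathbb{N}$ the function $t\mapsto (T_te^i)_j$ is Lebesgue measurable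 on $(0,\infty)$. Then: (a) for every $x\in E$ the map $t\mapsto T_tx$ is continuous from $(0,\infty)$ to $E$ with respect to the norm of $E$; (b) for all $i,j\in\mathbb{N}$, either $(T_te^i)_j>0$ for all $t>0$, or $(T_te^i)_j=0$ for all $t>0$. -/

import Mathlib

open Filter Topology MeasureTheory

/-- A sequence space: a linear subspace of the space `ℕ → ℝ` of all real sequences which is closed
under the componentwise lattice operations and contains all unit vectors. -/
structure SequenceSpace where
  toSubmodule : Submodule ℝ (ℕ → ℝ)
  sup_mem : ∀ x ∈ toSubmodule, ∀ y ∈ toSubmodule, x ⊔ y ∈ toSubmodule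
  inf_mem : ∀ x ∈ toSubmodule, ∀ y ∈ toSubmodule, x ⊓ y ∈ toSubmodule
  single_mem : ∀ k : ℕ, (Pi.single k 1 : ℕ → ℝ) ∈ toSubmodule

/-- A sequence space together with a norm on it (a seminorm that vanishes only at `0`).
The norm is neither required to be a lattice norm nor to be complete. -/
structure NormedSequenceSpace extends SequenceSpace where
  seqNorm : Seminorm ℝ toSubmodule
  eq_zero_of_seqNorm_eq_zero : ∀ x, seqNorm x = 0 → x = 0

namespace NormedSequenceSpace

/-- The elements of a normed sequence space. This is a type of its own, so that its topology
is that of the norm and not the topology of componentwise convergence. -/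
def Elem (E : NormedSequenceSpace) : Type := E.toSubmodule

variable (E : NormedSequenceSpace)

instance : AddCommGroup E.Elem := inferInstanceAs (AddCommGroup E.toSubmodule)

instance : Module ℝ E.Elem := inferInstanceAs (Module ℝ E.toSubmodule)

instance : Norm E.Elem := ⟨fun x => E.seqNorm x⟩

theorem normCore : NormedSpace.Core ℝ E.Elem where
  norm_nonneg x := apply_nonneg E.seqNorm x
  norm_smul c x := map_smul_eq_mul E.seqNorm c x
  norm_triangle x y := map_add_le_add E.seqNorm x y
  norm_eq_zero_iff x := ⟨E.eq_zero_of_seqNorm_eq_zero x, fun h => by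
    subst h; exact map_zero E.seqNorm⟩

noncomputable instance : NormedAddCommGroup E.Elem := NormedAddCommGroup.ofCore E.normCore

noncomputable instance : NormedSpace ℝ E.Elem := NormedSpace.ofCore E.normCore

/-- The components of an element: `x n` is the `n`-th term of the sequence `x`. -/
instance : CoeFun E.Elem (fun _ => ℕ → ℝ) := ⟨fun x => Subtype.val x⟩

/-- The componentwise order and lattice operations. -/
instance : Lattice E.Elem :=
  Subtype.lattice (P := fun x => x ∈ E.toSubmodule)
    (fun {x y} hx hy => E.sup_mem x hx y hy) (fun {x y} hx hy => E.inf_mem x hx y hy)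

/-- The `k`-th unit vector, as an element of `E`. -/
def unitVec (k : ℕ) : E.Elem := ⟨Pi.single k 1, E.single_mem k⟩

variable {E}

theorem le_iff (x y : E.Elem) : x ≤ y ↔ ∀ n, x n ≤ y n := Iff.rfl

theorem abs_apply (x : E.Elem) (n : ℕ) : (|x| : E.Elem) n = |x n| := rfl

/-- Order convergence of a sequence in `E`: it is order bounded in `E` and converges
componentwise. -/
def OrderConverges (u : ℕ → E.Elem) (x : E.Elem) : Prop :=
  (∃ a b : E.Elem, ∀ k, a ≤ u k ∧ u k ≤ b) ∧ ∀ n, Tendsto (fun k => u k n) atTop (𝓝 (x n))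

variable (E) in
/-- The norm of `E` is order continuous: every order convergent sequence converges in norm
(to its order limit). -/
def OrderContinuousNorm : Prop :=
  ∀ (u : ℕ → E.Elem) (x : E.Elem), OrderConverges u x → Tendsto u atTop (𝓝 x)

/-- `(T t)` for `t > 0` is a positive semigroup of linear operators on `E`. The values of `T` at
`t ≤ 0` play no role, and boundedness of the operators is not required. -/
structure IsPositiveSemigroup (T : ℝ → E.Elem →ₗ[ℝ] E.Elem) : Prop where
  map_add : ∀ t s : ℝ, 0 < t → 0 < s → T (t + s) = T t ∘ₗ T s
  nonneg : ∀ t : ℝ, 0 < t → ∀ x : E.Elem, 0 ≤ x → 0 ≤ T t x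

end NormedSequenceSpace

/-!
For (a): positive operators on a Banach lattice are bounded
(`exists_continuousLinearMap_of_nonneg`), and order continuity of the norm makes the unit vectors a
basis (`tendsto_sum_smul_unitVec`). So `E` is separable, and measurability of the matrix entries
gives strong measurability of every orbit `t ↦ T t x`. A strongly measurable semigroup of bounded
operators is strongly continuous on `(0, ∞)`: measurability and `T t = T s ∘ T (t - s)` bound
`‖T t‖` on compact intervals, and averaging `T t x - T ξ x = T τ (T (t - τ) x - T (ξ - τ) x)` over
`τ` reduces the claim to the continuity of translations in `L¹`.

For (b): the entries `p t i j = (T t eⁱ) j` form a continuous semigroup of nonnegative matrices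
(`IsMatrixSemigroup`), about which nothing is known as `t → 0`; in particular `p t i i → 1` may
fail. The dichotomy then rests on two facts.

* If `p t i j ≠ 0`, then `p r i j ≠ 0` for `r < t` (`ne_zero_of_lt`). Suppose `p r i j = 0` and let
  `ρ a ≤ r` be the last zero of `p · a j` up to time `r`. A transition of duration `h` cannot
  decrease `ρ` by more than `h`. As `ρ` takes only countably many values, it cannot drift downwards
  along a path: under the bridge from `i` to `j` in time `t`, the mean of `ρ` is
  nondecreasing (`bridge_mono`, through a Dini derivative). It starts at the maximal value `r`, so
  `ρ = r` almost surely at time `t - r`, contrary to the fact that `j` is reached from there in time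
  exactly `r`.
* If `k` lies between `i` and `j`, then `p q k k ≠ 0` for some `q` (`exists_diag_ne_zero`).
  Otherwise the bridge visits `k` at most once, so that the events of being in `k` at `N` different
  times are disjoint; but for times in a short interval their probabilities are bounded below, and
  `N` is arbitrary.

By the first fact and the semigroup law the diagonal entry at `k` never vanishes, and
waiting in `k` makes `p t i j` nonzero for arbitrarily large `t`, hence for all `t`.
-/

open scoped NNReal ENNReal

/-! ### Measurable semigroups of bounded operators -/

theorem tendsto_integral_norm_translate_sub {X : Type*} [NormedAddCommGroup X] {g : ℝ → X}
    (hg : Integrable g) :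
    Tendsto (fun h : ℝ => ∫ r, ‖g (h + r) - g r‖) (𝓝 0) (𝓝 0) := by
  have : Fact ((1 : ENNReal) ≠ ⊤) := ⟨ENNReal.one_ne_top⟩
  have hcont : Tendsto (fun h : ℝ => ‖(DomAddAct.mk h +ᵥ hg.toL1 g : Lp X 1 volume) - hg.toL1 g‖)
      (𝓝 0) (𝓝 0) := by
    have h1 : Continuous fun h : ℝ =>
        ‖(DomAddAct.mk h +ᵥ hg.toL1 g : Lp X 1 volume) - hg.toL1 g‖ := by
      refine continuous_norm.comp (Continuous.sub ?_ continuous_const)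
      exact Continuous.vadd DomAddAct.continuous_mk continuous_const
    have h2 := h1.tendsto 0
    simpa using h2
  refine hcont.congr fun h => ?_
  rw [L1.norm_eq_integral_norm]
  refine integral_congr_ae ?_
  have h3 := Lp.coeFn_sub (DomAddAct.mk h +ᵥ hg.toL1 g : Lp X 1 volume) (hg.toL1 g)
  have h4 := DomAddAct.vadd_Lp_ae_eq (DomAddAct.mk h) (hg.toL1 g)
  have h5 := hg.coeFn_toL1
  have h6 := (measurePreserving_add_left volume h).quasiMeasurePreserving.ae h5
  filter_upwards [h3, h4, h5, h6] with r h3 h4 h5 h6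
  rw [h3, Pi.sub_apply, h4, h5]
  rw [← h6]
  rfl

/-- A measurable semigroup is bounded on compact subintervals of `(0, ∞)`. If `‖S t‖ > n²`, then for
each `s ∈ (0, t)` one of `‖S s‖`, `‖S (t - s)‖` exceeds `n`, so `{‖S s‖ > n}` fills at least
half of `(0, t)`; this is impossible for large `n`. -/
theorem exists_norm_le_of_aestronglyMeasurable_semigroup {X : Type*} [NormedAddCommGroup X]
    [NormedSpace ℝ X] [TopologicalSpace.SeparableSpace X] {S : ℝ → X →L[ℝ] X}
    (hS : ∀ t s, 0 < t → 0 < s → S (t + s) = (S t).comp (S s))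
    (hm : ∀ x, AEStronglyMeasurable (fun t => S t x) (volume.restrict (Set.Ioi 0)))
    {α β : ℝ} (hα : 0 < α) : ∃ C, 0 ≤ C ∧ ∀ t ∈ Set.Icc α β, ‖S t‖ ≤ C := by
  let x : ℕ → X := TopologicalSpace.denseSeq X
  have hx : DenseRange x := TopologicalSpace.denseRange_denseSeq X
  -- `A n = {‖S t‖ > n}`, tested on a dense sequence, which makes it null measurable
  let A : ℕ → Set ℝ := fun n => {t | ∃ k, n * ‖x k‖ < ‖S t (x k)‖}
  have hA : ∀ n t, t ∉ A n → ‖S t‖ ≤ n := by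
    intro n t ht
    simp only [A, Set.mem_ofPred_eq, not_exists, not_lt] at ht
    refine ContinuousLinearMap.opNorm_le_bound _ (by positivity) fun y => ?_
    refine hx.induction_on (p := fun y => ‖S t y‖ ≤ n * ‖y‖) y ?_ ht
    exact isClosed_le (by fun_prop) (by fun_prop)
  let ν : Measure ℝ := volume.restrict (Set.Ioo 0 β)
  have hnull : ∀ n, NullMeasurableSet (A n) ν := by
    intro n
    have : A n = ⋃ k, {t | n * ‖x k‖ < ‖S t (x k)‖} := by ext; simp [A]
    rw [this]
    refine NullMeasurableSet.iUnion fun k => ?_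
    refine nullMeasurableSet_lt aemeasurable_const ?_
    have hmk := (hm (x k)).mono_measure
      (Measure.restrict_mono (Set.Ioo_subset_Ioi_self (a := β) (b := 0)) le_rfl)
    exact hmk.norm.aemeasurable
  have hanti : Antitone A := by
    rintro n m hnm t ⟨k, hk⟩
    refine ⟨k, lt_of_le_of_lt ?_ hk⟩
    gcongr
  have hempty : ⋂ n, A n = ∅ := by
    ext t
    simp only [Set.mem_iInter, Set.mem_empty_iff_false, iff_false, not_forall]
    obtain ⟨n, hn⟩ := exists_nat_ge ‖S t‖
    refine ⟨n, ?_⟩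
    rintro ⟨k, hk⟩
    have := (S t).le_opNorm (x k)
    nlinarith [norm_nonneg (x k)]
  have hlim : Tendsto (fun n => ν (A n)) atTop (𝓝 0) := by
    have := tendsto_measure_iInter_atTop (μ := ν) hnull hanti ⟨0, by
      refine ne_of_lt (lt_of_le_of_lt (measure_mono (Set.subset_univ _)) ?_)
      simp [ν]⟩
    simpa [hempty, Function.comp_def] using this
  obtain ⟨n, hn⟩ := (hlim.eventually (gt_mem_nhds (show (0 : ENNReal) < ENNReal.ofReal (α / 2) by
    simpa using hα))).exists
  refine ⟨(n : ℝ) * n, by positivity, fun t ht => ?_⟩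
  by_contra! hlt
  -- one of `s`, `t - s` lies in `A n` for every `s` between `0` and `t`
  have hcover : Set.Ioo 0 t ⊆ (A n ∩ Set.Ioo 0 t) ∪
      (MeasurableEquiv.subLeft t) ⁻¹' (A n ∩ Set.Ioo 0 t) := by
    rintro s ⟨hs0, hst⟩
    by_contra hs
    simp only [Set.mem_union, Set.mem_inter_iff, Set.mem_Ioo, Set.mem_preimage,
      not_or, not_and] at hs
    change (s ∈ A n → 0 < s → ¬ s < t) ∧ (t - s ∈ A n → 0 < t - s → ¬ t - s < t) at hs
    have h1 : ‖S s‖ ≤ n := hA n s fun h => hs.1 h hs0 hst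
    have h2 : ‖S (t - s)‖ ≤ n := hA n _ fun h => hs.2 h (by linarith) (by linarith)
    have h3 : S t = (S (t - s)).comp (S s) := by
      rw [← hS _ _ (by linarith) hs0]; simp
    have h4 : ‖S t‖ ≤ ‖S (t - s)‖ * ‖S s‖ := by
      rw [h3]; exact ContinuousLinearMap.opNorm_comp_le _ _
    have h5 : ‖S (t - s)‖ * ‖S s‖ ≤ n * n := by gcongr
    linarith
  have hvol : volume (A n ∩ Set.Ioo 0 t) < ENNReal.ofReal (α / 2) := by
    refine lt_of_le_of_lt ?_ hn
    rw [Measure.restrict_apply' measurableSet_Ioo]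
    exact measure_mono (Set.inter_subset_inter_right _ (Set.Ioo_subset_Ioo_right ht.2))
  have h1 : volume (Set.Ioo 0 t) < ENNReal.ofReal (α / 2) + ENNReal.ofReal (α / 2) := by
    refine lt_of_le_of_lt ((measure_mono hcover).trans (measure_union_le _ _)) ?_
    rw [MeasurePreserving.measure_preimage_equiv (f := MeasurableEquiv.subLeft t)
      (Measure.measurePreserving_sub_left volume t)]
    exact ENNReal.add_lt_add hvol hvol
  rw [Real.volume_Ioo, ← ENNReal.ofReal_add (by linarith) (by linarith)] at h1
  have := (ENNReal.ofReal_lt_ofReal_iff (by linarith)).1 h1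
  linarith [ht.1]

/-- A strongly measurable semigroup on a separable normed space is strongly continuous
on `(0, ∞)`. -/
theorem continuousOn_of_aestronglyMeasurable_semigroup {X : Type*} [NormedAddCommGroup X]
    [NormedSpace ℝ X] [TopologicalSpace.SeparableSpace X] {S : ℝ → X →L[ℝ] X}
    (hS : ∀ t s, 0 < t → 0 < s → S (t + s) = (S t).comp (S s))
    (hm : ∀ x, AEStronglyMeasurable (fun t => S t x) (volume.restrict (Set.Ioi 0))) (x : X) :
    ContinuousOn (fun t => S t x) (Set.Ioi 0) := by
  intro ξ hξ
  replace hξ : 0 < ξ := hξ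
  refine ContinuousAt.continuousWithinAt ?_
  obtain ⟨C, hC0, hC⟩ := exists_norm_le_of_aestronglyMeasurable_semigroup hS hm (α := ξ / 4)
    (β := ξ) (by linarith)
  -- the orbit is cut off to an integrable function on the line
  let I : Set ℝ := Set.Icc (ξ / 4) ξ
  let g : ℝ → X := I.indicator fun t => S t x
  have hg : Integrable g := by
    rw [integrable_indicator_iff measurableSet_Icc]
    refine IntegrableOn.of_bound (by simp) ?_ (C * ‖x‖) ?_
    · refine (hm x).mono_measure (Measure.restrict_mono ?_ le_rfl)
      intro t ht
      exact lt_of_lt_of_le (by linarith) ht.1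
    · filter_upwards [ae_restrict_mem measurableSet_Icc] with t ht
      exact (S t).le_of_opNorm_le (hC t ht) x
  have hlim : Tendsto (fun t => C * (ξ / 4)⁻¹ * ∫ r, ‖g ((t - ξ) + r) - g r‖) (𝓝 ξ) (𝓝 0) := by
    have h1 : Tendsto (fun t : ℝ => t - ξ) (𝓝 ξ) (𝓝 0) := by
      have : Continuous fun t : ℝ => t - ξ := by fun_prop
      simpa using this.tendsto ξ
    simpa using ((tendsto_integral_norm_translate_sub hg).comp h1).const_mul (C * (ξ / 4)⁻¹)
  refine tendsto_iff_norm_sub_tendsto_zero.2 ?_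
  refine squeeze_zero' (Eventually.of_forall fun t => norm_nonneg _) ?_ hlim
  have hnear : ∀ᶠ t in 𝓝 ξ, t ∈ Set.Ioo (ξ - ξ / 4) (ξ + ξ / 4) :=
    Ioo_mem_nhds (by linarith) (by linarith)
  filter_upwards [hnear] with t ht
  have hint : Integrable fun r => ‖g ((t - ξ) + r) - g r‖ :=
    ((hg.comp_add_left (t - ξ)).sub hg).norm
  -- here `ξ - r` lies between `ξ / 4` and `ξ / 2`, where `S` is bounded by `C`
  have hpt : ∀ r ∈ Set.Icc (ξ / 2) (3 * ξ / 4), ‖S t x - S ξ x‖ ≤ C * ‖g ((t - ξ) + r) - g r‖ := by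
    intro r hr
    obtain ⟨hr1, hr2⟩ := hr
    obtain ⟨ht1, ht2⟩ := ht
    have e1 : g ((t - ξ) + r) = S ((t - ξ) + r) x :=
      Set.indicator_of_mem (show (t - ξ) + r ∈ I from ⟨by linarith, by linarith⟩) _
    have e2 : g r = S r x := Set.indicator_of_mem (show r ∈ I from ⟨by linarith, by linarith⟩) _
    have e3 : S t x = S (ξ - r) (S ((t - ξ) + r) x) := by
      rw [← ContinuousLinearMap.comp_apply, ← hS _ _ (by linarith) (by linarith)]
      congr 2; ring
    have e4 : S ξ x = S (ξ - r) (S r x) := by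
      rw [← ContinuousLinearMap.comp_apply, ← hS _ _ (by linarith) (by linarith)]
      congr 2; ring
    rw [e1, e2, e3, e4, ← map_sub]
    exact (S (ξ - r)).le_of_opNorm_le (hC _ ⟨by linarith, by linarith⟩) _
  have h1 : ∫ _ in Set.Icc (ξ / 2) (3 * ξ / 4), ‖S t x - S ξ x‖ ≤
      ∫ r in Set.Icc (ξ / 2) (3 * ξ / 4), C * ‖g ((t - ξ) + r) - g r‖ :=
    setIntegral_mono_on (by simp) (hint.const_mul C).integrableOn measurableSet_Icc hpt
  have h2 : ∫ r in Set.Icc (ξ / 2) (3 * ξ / 4), C * ‖g ((t - ξ) + r) - g r‖ ≤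
      ∫ r, C * ‖g ((t - ξ) + r) - g r‖ :=
    setIntegral_le_integral (hint.const_mul C) (Eventually.of_forall fun r => by positivity)
  have h3 : ∫ _ in Set.Icc (ξ / 2) (3 * ξ / 4), ‖S t x - S ξ x‖ = ξ / 4 * ‖S t x - S ξ x‖ := by
    rw [setIntegral_const, smul_eq_mul, measureReal_def, Real.volume_Icc,
      ENNReal.toReal_ofReal (by linarith)]
    ring
  rw [h3] at h1
  have h4 := h1.trans h2
  rw [integral_const_mul] at h4
  rw [mul_right_comm, ← div_eq_mul_inv, le_div_iff₀ (by linarith), mul_comm]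
  exact h4

/-! ### Matrix semigroups and their bridges -/

/-- A continuous semigroup `p t`, `t > 0`, of nonnegative matrices over an arbitrary index set. The
products of the matrices are formed in `ℝ≥0∞`, so that their convergence is part of the semigroup
law. There is no condition as `t → 0`. -/
structure IsMatrixSemigroup {ι : Type*} (p : ℝ → ι → ι → ℝ≥0) : Prop where
  add : ∀ t s, 0 < t → 0 < s → ∀ i j, (p (t + s) i j : ℝ≥0∞) = ∑' k, (p t i k : ℝ≥0∞) * p s k j
  continuousOn : ∀ i j, ContinuousOn (fun t => p t i j) (Set.Ioi 0)

/-- The unnormalised expectation of `φ` at time `s` under the bridge from `i` to `j` of length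
`t`, the measure on the index set with the weights `p s i a * p (t - s) a j`. -/
noncomputable def bridge {ι : Type*} (p : ℝ → ι → ι → ℝ≥0) (i j : ι) (t : ℝ) (φ : ι → ℝ≥0∞)
    (s : ℝ) : ℝ≥0∞ :=
  ∑' a, (p s i a : ℝ≥0∞) * p (t - s) a j * φ a

/-- The supremum of the zeros of `p · a j` in `(0, c]`, and `0` if there are none. -/
noncomputable def lastZero {ι : Type*} (p : ℝ → ι → ι → ℝ≥0) (j : ι) (c : ℝ) (a : ι) : ℝ :=
  sSup (insert 0 {r | 0 < r ∧ r ≤ c ∧ p r a j = 0})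

namespace IsMatrixSemigroup

variable {ι : Type*} {p : ℝ → ι → ι → ℝ≥0} (hp : IsMatrixSemigroup p)

include hp

theorem mul_le {t s : ℝ} (ht : 0 < t) (hs : 0 < s) (i k j : ι) :
    p t i k * p s k j ≤ p (t + s) i j := by
  have h := ENNReal.le_tsum (f := fun k => (p t i k : ℝ≥0∞) * p s k j) k
  rw [← hp.add t s ht hs] at h
  exact_mod_cast h

theorem add_ne_zero {t s : ℝ} (ht : 0 < t) (hs : 0 < s) {i k j : ι} (h1 : p t i k ≠ 0)
    (h2 : p s k j ≠ 0) : p (t + s) i j ≠ 0 :=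
  ((pos_iff_ne_zero.2 (mul_ne_zero h1 h2)).trans_le (hp.mul_le ht hs i k j)).ne'

theorem exists_ne_zero {t s : ℝ} (ht : 0 < t) (hs : 0 < s) {i j : ι} (h : p (t + s) i j ≠ 0) :
    ∃ k, p t i k ≠ 0 ∧ p s k j ≠ 0 := by
  by_contra! hk
  have h1 := hp.add t s ht hs i j
  rw [ENNReal.tsum_eq_zero.2] at h1
  · exact h (by exact_mod_cast h1)
  · intro k
    by_cases h2 : p t i k = 0
    · simp [h2]
    · simp [hk k h2]

theorem continuousOn_bridge_weight (i j a : ι) (t : ℝ) :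
    ContinuousOn (fun s => p s i a * p (t - s) a j) (Set.Ioo 0 t) := by
  refine ((hp.continuousOn i a).mono fun s hs => hs.1).mul ?_
  exact (hp.continuousOn a j).comp (by fun_prop) fun s hs => sub_pos.2 hs.2

theorem bridge_one {i j : ι} {t s : ℝ} (hs : s ∈ Set.Ioo 0 t) :
    bridge p i j t 1 s = p t i j := by
  have := hp.add s (t - s) hs.1 (sub_pos.2 hs.2) i j
  rw [add_sub_cancel] at this
  simp [bridge, this]

theorem bridge_const {i j : ι} {t s : ℝ} (hs : s ∈ Set.Ioo 0 t) (c : ℝ≥0∞) :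
    bridge p i j t (fun _ => c) s = p t i j * c := by
  rw [← hp.bridge_one hs, bridge, ENNReal.tsum_mul_right]
  simp [bridge]

theorem bridge_ne_top {i j : ι} {t s : ℝ} (hs : s ∈ Set.Ioo 0 t) {φ : ι → ℝ≥0∞} {c : ℝ≥0}
    (hφ : ∀ a, φ a ≤ c) : bridge p i j t φ s ≠ ⊤ := by
  have h : bridge p i j t φ s ≤ bridge p i j t (fun _ => (c : ℝ≥0∞)) s :=
    ENNReal.tsum_le_tsum fun a => by gcongr; exact hφ a
  rw [hp.bridge_const hs] at h
  exact ne_top_of_le_ne_top (ENNReal.mul_ne_top ENNReal.coe_ne_top ENNReal.coe_ne_top) h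

omit hp in
theorem bridge_mul_const {i j : ι} {t s : ℝ} (φ : ι → ℝ≥0∞) (c : ℝ≥0∞) :
    bridge p i j t (fun a => φ a * c) s = bridge p i j t φ s * c := by
  simp only [bridge, ← ENNReal.tsum_mul_right, mul_assoc]

/-- Both `bridge φ` and `bridge (c - φ)` are lower semicontinuous, as sums of nonnegative continuous
functions, and they add up to a constant. -/
theorem continuousOn_bridge (i j : ι) (t : ℝ) {φ : ι → ℝ≥0∞} {c : ℝ≥0} (hφ : ∀ a, φ a ≤ c) :
    ContinuousOn (bridge p i j t φ) (Set.Ioo 0 t) := by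
  have hlsc : ∀ ψ : ι → ℝ≥0∞, (∀ a, ψ a ≤ c) →
      LowerSemicontinuousOn (bridge p i j t ψ) (Set.Ioo 0 t) := by
    intro ψ hψ
    refine lowerSemicontinuousOn_tsum fun a => ContinuousOn.lowerSemicontinuousOn ?_
    refine (ENNReal.continuous_mul_const
      (ne_top_of_le_ne_top ENNReal.coe_ne_top (hψ a))).comp_continuousOn ?_
    exact_mod_cast ENNReal.continuous_coe.comp_continuousOn (hp.continuousOn_bridge_weight i j a t)
  rw [continuousOn_iff_lower_upperSemicontinuousOn]
  refine ⟨hlsc φ hφ, ?_⟩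
  have hsub := hlsc (fun a => c - φ a) fun a => tsub_le_self
  have hadd : ∀ s ∈ Set.Ioo 0 t,
      bridge p i j t φ s = p t i j * c - bridge p i j t (fun a => c - φ a) s := by
    intro s hs
    refine ENNReal.eq_sub_of_add_eq (hp.bridge_ne_top hs fun a => tsub_le_self) ?_
    rw [← hp.bridge_const hs, bridge, bridge, bridge, ← ENNReal.tsum_add]
    refine tsum_congr fun a => ?_
    rw [← mul_add, add_tsub_cancel_of_le (hφ a)]
  have husc : UpperSemicontinuousOn
      (fun s => p t i j * c - bridge p i j t (fun a => c - φ a) s) (Set.Ioo 0 t) := by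
    refine Continuous.comp_lowerSemicontinuousOn_antitone (g := fun x : ℝ≥0∞ => p t i j * c - x)
      (ENNReal.continuous_sub_left (ENNReal.mul_ne_top ENNReal.coe_ne_top ENNReal.coe_ne_top))
      hsub fun x y hxy => tsub_le_tsub_left hxy _
  intro s hs y hy
  rw [hadd s hs] at hy
  filter_upwards [husc s hs y hy, self_mem_nhdsWithin] with z hz hz'
  rwa [hadd z hz']

/-- Comparison of expectations at the times `s` and `s + h`, from a comparison along the transitions
of duration `h`. -/
theorem bridge_le_bridge_add {i j : ι} {t s h : ℝ} (hs : 0 < s) (hh : 0 < h) (hsh : s + h < t)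
    {φ ψ χ θ : ι → ℝ≥0∞} (hle : ∀ a b, p h a b ≠ 0 → φ a ≤ ψ b + χ a + θ b) :
    bridge p i j t φ s ≤
      bridge p i j t ψ (s + h) + bridge p i j t χ s + bridge p i j t θ (s + h) := by
  have hl : ∀ f : ι → ℝ≥0∞, bridge p i j t f s =
      ∑' a, ∑' b, (p s i a : ℝ≥0∞) * p h a b * p (t - (s + h)) b j * f a := by
    intro f
    refine tsum_congr fun a => ?_
    have := hp.add h (t - (s + h)) hh (by linarith) a j
    rw [show h + (t - (s + h)) = t - s by ring] at this
    rw [this, ← ENNReal.tsum_mul_left, ← ENNReal.tsum_mul_right]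
    exact tsum_congr fun b => by ring
  have hr : ∀ f : ι → ℝ≥0∞, bridge p i j t f (s + h) =
      ∑' a, ∑' b, (p s i a : ℝ≥0∞) * p h a b * p (t - (s + h)) b j * f b := by
    intro f
    rw [ENNReal.tsum_comm]
    refine tsum_congr fun b => ?_
    rw [hp.add s h hs hh i b, ← ENNReal.tsum_mul_right, ← ENNReal.tsum_mul_right]
  rw [hl, hl, hr, hr, ← ENNReal.tsum_add, ← ENNReal.tsum_add]
  refine ENNReal.tsum_le_tsum fun a => ?_
  rw [← ENNReal.tsum_add, ← ENNReal.tsum_add]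
  refine ENNReal.tsum_le_tsum fun b => ?_
  by_cases h0 : p h a b = 0
  · simp [h0]
  · rw [← mul_add, ← mul_add]
    gcongr
    exact hle a b h0

/-- Tightness: a finite set carries all but `ε` of the mass of the bridge at time `s`. -/
theorem exists_finset_bridge_compl_lt {i j : ι} {t s : ℝ} (hs : s ∈ Set.Ioo 0 t) {ε : ℝ≥0∞}
    (hε : 0 < ε) :
    ∃ F : Finset ι, bridge p i j t ((F : Set ι)ᶜ.indicator 1) s < ε := by
  have hsum : ∑' a, (p s i a : ℝ≥0∞) * p (t - s) a j ≠ ⊤ := by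
    have h := hp.bridge_one (i := i) (j := j) hs
    simp only [bridge, Pi.one_apply, mul_one] at h
    rw [h]; exact ENNReal.coe_ne_top
  obtain ⟨F, hF⟩ := ((ENNReal.tendsto_tsum_compl_atTop_zero hsum).eventually
    (gt_mem_nhds hε)).exists
  refine ⟨F, lt_of_eq_of_lt ?_ hF⟩
  have := tsum_subtype ((F : Set ι)ᶜ) fun a => (p s i a : ℝ≥0∞) * p (t - s) a j
  refine Eq.trans ?_ this.symm
  refine tsum_congr fun a => ?_
  by_cases ha : a ∈ F <;> simp [ha]

/-- If `ρ` never drops by more than the elapsed time along the transitions, then its mean under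
the bridge is monotone. On a finite set that carries almost all of the mass, `ρ` takes finitely many
values, so it cannot drop at all in a short time; the rest of the mass loses at most `h` in time
`h`. So the lower right Dini derivative of the mean is nonnegative. -/
theorem bridge_mono {i j : ι} {t : ℝ} {ρ : ι → ℝ} {c : ℝ≥0} (hρc : ∀ a, ρ a ≤ c)
    (hρ : ∀ h a b, 0 < h → p h a b ≠ 0 → ρ a ≤ ρ b + h) {u v : ℝ} (hu : 0 < u) (huv : u ≤ v)
    (hv : v < t) :
    bridge p i j t (fun a => ENNReal.ofReal (ρ a)) u ≤
      bridge p i j t (fun a => ENNReal.ofReal (ρ a)) v := by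
  have hbd : ∀ a, ENNReal.ofReal (ρ a) ≤ c := fun a => by
    rw [← ENNReal.ofReal_coe_nnreal]; exact ENNReal.ofReal_le_ofReal (hρc a)
  set W := bridge p i j t (fun a => ENNReal.ofReal (ρ a))
  have hfin : ∀ s ∈ Set.Ioo 0 t, W s ≠ ⊤ := fun s hs => hp.bridge_ne_top hs hbd
  have hcont : ContinuousOn (fun s => -(W s).toReal) (Set.Icc u v) := by
    refine ContinuousOn.neg fun s hs => ?_
    have hs' : s ∈ Set.Ioo 0 t := ⟨hu.trans_le hs.1, hs.2.trans_lt hv⟩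
    exact (ENNReal.tendsto_toReal (hfin s hs')).comp
      ((hp.continuousOn_bridge i j t hbd s hs').mono_left
        (nhdsWithin_mono _ fun x hx => ⟨hu.trans_le hx.1, hx.2.trans_lt hv⟩))
  have hdini : ∀ s ∈ Set.Ico u v, ∀ r : ℝ, 0 < r →
      ∃ᶠ z in 𝓝[>] s, slope (fun s => -(W s).toReal) s z < r := by
    intro s hs r hr
    have hs' : s ∈ Set.Ioo 0 t := ⟨hu.trans_le hs.1, hs.2.trans hv⟩
    obtain ⟨F, hF⟩ := hp.exists_finset_bridge_compl_lt (i := i) (j := j) hs'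
      (ε := ENNReal.ofReal (r / 3)) (by simpa using hr)
    set tail : ℝ → ℝ≥0∞ := bridge p i j t ((F : Set ι)ᶜ.indicator 1) with htail
    have hone : ∀ a, (F : Set ι)ᶜ.indicator (1 : ι → ℝ≥0∞) a ≤ (1 : ℝ≥0) := fun a =>
      Set.indicator_le_self' (f := (1 : ι → ℝ≥0∞)) (fun _ _ => zero_le) a
    have htc : ContinuousAt tail s :=
      (hp.continuousOn_bridge i j t hone).continuousAt (Ioo_mem_nhds hs'.1 hs'.2)
    have h1 : ∀ᶠ z in 𝓝[>] s, tail z < ENNReal.ofReal (r / 3) :=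
      (htc.eventually (gt_mem_nhds hF)).filter_mono nhdsWithin_le_nhds
    have h2 : ∀ᶠ z in 𝓝[>] s, ∀ a ∈ F, ∀ b ∈ F, ρ b < ρ a → z < s + (ρ a - ρ b) := by
      refine Eventually.filter_mono nhdsWithin_le_nhds ?_
      refine (Finset.eventually_all F).2 fun a _ => (Finset.eventually_all F).2 fun b _ => ?_
      by_cases hab : ρ b < ρ a
      · simpa [hab] using gt_mem_nhds (show s < s + (ρ a - ρ b) by linarith)
      · simp [hab]
    have h3 : ∀ᶠ z in 𝓝[>] s, z < t := (gt_mem_nhds hs'.2).filter_mono nhdsWithin_le_nhds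
    refine Eventually.frequently ?_
    filter_upwards [h1, h2, h3, self_mem_nhdsWithin] with z hz1 hz2 hz3 hz4
    replace hz4 : s < z := hz4
    obtain ⟨h, rfl⟩ : ∃ h, z = s + h := ⟨z - s, by ring⟩
    have hh : 0 < h := by linarith
    have key : W s ≤ W (s + h) + tail s * ENNReal.ofReal h + tail (s + h) * ENNReal.ofReal h := by
      rw [htail, ← bridge_mul_const, ← bridge_mul_const]
      refine hp.bridge_le_bridge_add hs'.1 hh hz3 fun a b hab => ?_
      have hle : ENNReal.ofReal (ρ a) ≤ ENNReal.ofReal (ρ b) + ENNReal.ofReal h :=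
        (ENNReal.ofReal_le_ofReal (hρ h a b hh hab)).trans ENNReal.ofReal_add_le
      by_cases ha : a ∈ F
      · by_cases hb : b ∈ F
        · have : ρ a ≤ ρ b := by
            by_contra! hlt
            have := hz2 a ha b hb hlt
            have := hρ h a b hh hab
            linarith
          simpa [ha, hb] using ENNReal.ofReal_le_ofReal this
        · simpa [ha, hb] using hle
      · refine hle.trans (le_trans ?_ le_self_add)
        simp [ha]
    have hz : s + h ∈ Set.Ioo 0 t := ⟨hs'.1.trans hz4, hz3⟩
    have key' : W s ≤ ENNReal.ofReal ((W (s + h)).toReal + r / 3 * h + r / 3 * h) := by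
      rw [ENNReal.ofReal_add (by positivity) (by positivity),
        ENNReal.ofReal_add (by positivity) (by positivity), ENNReal.ofReal_toReal (hfin _ hz),
        ENNReal.ofReal_mul (by positivity)]
      refine key.trans ?_
      gcongr
    have key2 : (W s).toReal ≤ (W (s + h)).toReal + r / 3 * h + r / 3 * h :=
      ENNReal.toReal_le_of_le_ofReal (by positivity) key'
    rw [slope_def_field, add_sub_cancel_left, div_lt_iff₀ hh]
    nlinarith
  have := image_le_of_liminf_slope_right_le_deriv_boundary hcont (B := fun _ => -(W u).toReal)
    (B' := fun _ => 0) le_rfl continuousOn_const (fun x _ => hasDerivWithinAt_const _ _ _)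
    hdini (Set.right_mem_Icc.2 huv)
  have h2 := neg_le_neg_iff.1 this
  exact (ENNReal.toReal_le_toReal (hfin u ⟨hu, huv.trans_lt hv⟩)
    (hfin v ⟨hu.trans_le huv, hv⟩)).1 h2

end IsMatrixSemigroup

/-! ### Zeros of the matrix entries -/

namespace IsMatrixSemigroup

variable {ι : Type*} {p : ℝ → ι → ι → ℝ≥0}

theorem bddAbove_lastZero_set (j : ι) {c : ℝ} (hc : 0 ≤ c) (a : ι) :
    BddAbove (insert 0 {r | 0 < r ∧ r ≤ c ∧ p r a j = 0}) := by
  refine ⟨c, ?_⟩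
  rintro r (rfl | hr)
  exacts [hc, hr.2.1]

theorem lastZero_nonneg (j : ι) {c : ℝ} (hc : 0 ≤ c) (a : ι) : 0 ≤ lastZero p j c a :=
  le_csSup (bddAbove_lastZero_set j hc a) (Set.mem_insert _ _)

theorem lastZero_le (j : ι) {c : ℝ} (hc : 0 ≤ c) (a : ι) : lastZero p j c a ≤ c := by
  refine csSup_le (Set.insert_nonempty _ _) ?_
  rintro r (rfl | hr)
  exacts [hc, hr.2.1]

theorem le_lastZero {j : ι} {c r : ℝ} {a : ι} (hr : 0 < r) (hrc : r ≤ c) (h : p r a j = 0) :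
    r ≤ lastZero p j c a :=
  le_csSup (bddAbove_lastZero_set j (hr.le.trans hrc) a) (Set.mem_insert_of_mem _ ⟨hr, hrc, h⟩)

variable (hp : IsMatrixSemigroup p)

include hp

/-- The zeros of `p · a j` form a closed set, so the supremum `c` would itself be a zero. -/
theorem lastZero_lt {j : ι} {c : ℝ} (hc : 0 < c) {a : ι} (h : p c a j ≠ 0) :
    lastZero p j c a < c := by
  have hcont : ContinuousAt (fun t => p t a j) c :=
    (hp.continuousOn a j).continuousAt (Ioi_mem_nhds hc)
  obtain ⟨l, hl, hl'⟩ := exists_Ioc_subset_of_mem_nhds (hcont.eventually_ne h) ⟨0, hc⟩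
  refine lt_of_le_of_lt ?_ (max_lt hl hc)
  refine csSup_le (Set.insert_nonempty _ _) ?_
  rintro r (rfl | ⟨-, hrc, hr⟩)
  · exact le_max_right _ _
  · refine le_max_of_le_left ?_
    by_contra! hlr
    exact hl' ⟨hlr, hrc⟩ hr

theorem lastZero_le_add {j : ι} {c : ℝ} (hc : 0 ≤ c) {h : ℝ} {a b : ι} (hh : 0 < h)
    (hab : p h a b ≠ 0) : lastZero p j c a ≤ lastZero p j c b + h := by
  have h0 := lastZero_nonneg (p := p) j hc b
  refine csSup_le (Set.insert_nonempty _ _) ?_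
  rintro r (rfl | ⟨hr, hrc, hz⟩)
  · positivity
  · by_cases hrh : r ≤ h
    · linarith
    · push Not at hrh
      rw [← sub_le_iff_le_add]
      refine le_lastZero (sub_pos.2 hrh) (by linarith) ?_
      by_contra hne
      refine hp.add_ne_zero hh (sub_pos.2 hrh) hab hne ?_
      rwa [add_sub_cancel]

/-- If `p t i j ≠ 0`, then the entry does not vanish at any earlier time either. -/
theorem ne_zero_of_lt {i j : ι} {r t : ℝ} (hr : 0 < r) (hrt : r < t) (h : p t i j ≠ 0) :
    p r i j ≠ 0 := by
  intro hz
  set R : ι → ℝ≥0∞ := fun a => ENNReal.ofReal (lastZero p j r a)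
  have hs : t - r ∈ Set.Ioo 0 t := ⟨by linarith, by linarith⟩
  obtain ⟨a, ha1, ha2⟩ := hp.exists_ne_zero (t := t - r) (s := r) (by linarith) hr
    (i := i) (j := j) (by simpa using h)
  -- at time `t - r` the bridge charges a state `a` from which `j` is reached in time `r`
  have hlt : bridge p i j t R (t - r) < p t i j * ENNReal.ofReal r := by
    rw [← hp.bridge_const hs]
    refine ENNReal.tsum_lt_tsum (i := a) ?_ (fun b => ?_) ?_
    · refine hp.bridge_ne_top hs (c := r.toNNReal) fun b => ?_
      exact ENNReal.ofReal_le_ofReal (lastZero_le j hr.le b)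
    · exact mul_le_mul_right (ENNReal.ofReal_le_ofReal (lastZero_le j hr.le b)) _
    · rw [sub_sub_cancel]
      refine ENNReal.mul_lt_mul_right ?_ ?_ ?_
      · simp [ha1, ha2]
      · exact ENNReal.mul_ne_top ENNReal.coe_ne_top ENNReal.coe_ne_top
      · exact (ENNReal.ofReal_lt_ofReal_iff hr).2 (hp.lastZero_lt hr ha2)
  -- at a small time `δ` the value of `lastZero` has dropped from `r` to `r - δ` at most
  have hge : ∀ δ ∈ Set.Ioo 0 (t - r),
      (p t i j : ℝ≥0∞) * ENNReal.ofReal (r - δ) ≤ bridge p i j t R (t - r) := by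
    intro δ hδ
    refine le_trans ?_ (hp.bridge_mono (c := r.toNNReal) (ρ := lastZero p j r)
      (fun a => by rw [Real.coe_toNNReal _ hr.le]; exact lastZero_le j hr.le a)
      (fun h a b hh hab => hp.lastZero_le_add hr.le hh hab) hδ.1 hδ.2.le (by linarith))
    rw [← hp.bridge_const (s := δ) ⟨hδ.1, by linarith [hδ.2]⟩]
    refine ENNReal.tsum_le_tsum fun b => ?_
    by_cases hb : p δ i b = 0
    · simp [hb]
    · refine mul_le_mul_right (ENNReal.ofReal_le_ofReal ?_) _
      have h1 := le_lastZero hr le_rfl hz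
      have h2 := hp.lastZero_le_add (j := j) hr.le hδ.1 hb
      linarith
  have hlim : Tendsto (fun δ : ℝ => (p t i j : ℝ≥0∞) * ENNReal.ofReal (r - δ)) (𝓝[>] 0)
      (𝓝 (p t i j * ENNReal.ofReal r)) := by
    have hcont : Continuous fun δ : ℝ => (p t i j : ℝ≥0∞) * ENNReal.ofReal (r - δ) :=
      (ENNReal.continuous_const_mul ENNReal.coe_ne_top).comp
        (ENNReal.continuous_ofReal.comp (by fun_prop))
    simpa using (hcont.tendsto 0).mono_left nhdsWithin_le_nhds
  refine hlt.not_ge (le_of_tendsto hlim ?_)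
  filter_upwards [Ioo_mem_nhdsGT (show (0 : ℝ) < t - r by linarith)] with δ hδ using hge δ hδ

/-- A diagonal entry that does not vanish at `s` does not vanish at the multiples of `s`, hence
nowhere on `(0, ∞)`. -/
theorem diag_ne_zero {k : ι} {s t : ℝ} (hs : 0 < s) (h : p s k k ≠ 0) (ht : 0 < t) :
    p t k k ≠ 0 := by
  have hn : ∀ n : ℕ, p ((n + 1) * s) k k ≠ 0 := by
    intro n
    induction n with
    | zero => simpa using h
    | succ n ih =>
      have := hp.add_ne_zero (by positivity) hs ih h
      rw [show ((n : ℝ) + 1) * s + s = ((n + 1 : ℕ) + 1) * s by push_cast; ring] at this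
      exact this
  obtain ⟨n, hnt⟩ := exists_nat_gt (t / s)
  refine hp.ne_zero_of_lt ht ?_ (hn n)
  rw [div_lt_iff₀ hs] at hnt
  linarith

/-- If it is impossible to return to `k`, then the events of being in `k` at the times `u m` are
disjoint. -/
theorem sum_le_of_diag_eq_zero {k : ι} (hk : ∀ s, 0 < s → p s k k = 0) {u : ℕ → ℝ}
    (hu : StrictMono u) (hu0 : 0 < u 0) (i : ι) (N : ℕ) :
    ∀ t, 0 < t → (∀ m < N, u m < t) → ∀ b,
      ∑ m ∈ Finset.range N, p (u m) i k * p (t - u m) k b ≤ p t i b := by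
  classical
  have hupos : ∀ m, 0 < u m := fun m => hu0.trans_le (hu.monotone (Nat.zero_le m))
  induction N with
  | zero => simp
  | succ N ih =>
    intro t ht hlt b
    have htN : 0 < t - u N := sub_pos.2 (hlt N N.lt_succ_self)
    -- for `a = k` only the last summand is nonzero, for `a ≠ k` it is the induction hypothesis
    have hdom : ∀ a, ∑ m ∈ Finset.range N, p (u m) i k * p (u N - u m) k a +
        (if a = k then p (u N) i k else 0) ≤ p (u N) i a := by
      intro a
      by_cases ha : a = k
      · subst ha
        rw [if_pos rfl, Finset.sum_eq_zero, zero_add]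
        intro m hm
        rw [hk _ (sub_pos.2 (hu (Finset.mem_range.1 hm))), mul_zero]
      · rw [if_neg ha, add_zero]
        exact ih (u N) (hupos N) (fun m hm => hu hm) a
    have hck : ∀ m ∈ Finset.range N, (p (t - u m) k b : ℝ≥0∞) =
        ∑' a, (p (u N - u m) k a : ℝ≥0∞) * p (t - u N) a b := by
      intro m hm
      rw [← hp.add _ _ (sub_pos.2 (hu (Finset.mem_range.1 hm))) htN]
      congr 3; ring
    have hmain : ((∑ m ∈ Finset.range (N + 1), p (u m) i k * p (t - u m) k b : ℝ≥0) : ℝ≥0∞) ≤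
        p t i b := by
      calc ((∑ m ∈ Finset.range (N + 1), p (u m) i k * p (t - u m) k b : ℝ≥0) : ℝ≥0∞)
          = ∑' a, ((∑ m ∈ Finset.range N, p (u m) i k * p (u N - u m) k a +
              (if a = k then p (u N) i k else 0) : ℝ≥0) : ℝ≥0∞) * p (t - u N) a b := by
            rw [Finset.sum_range_succ]
            push_cast
            simp only [add_mul, Finset.sum_mul]
            rw [ENNReal.tsum_add, Summable.tsum_finsetSum fun _ _ => ENNReal.summable]
            congr 1
            · refine Finset.sum_congr rfl fun m hm => ?_
              rw [hck m hm, ← ENNReal.tsum_mul_left]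
              exact tsum_congr fun a => by ring
            · rw [tsum_eq_single k (fun a ha => by simp [ha])]
              simp
        _ ≤ ∑' a, (p (u N) i a : ℝ≥0∞) * p (t - u N) a b :=
            ENNReal.tsum_le_tsum fun a => by
              gcongr
              exact hdom a
        _ = p t i b := by
            rw [← hp.add _ _ (hupos N) htN, add_sub_cancel]
    exact_mod_cast hmain

/-- A state between `i` and `j` can return to itself: otherwise it is visited at most once, although
the probability of being there is bounded below during an interval of times. -/
theorem exists_diag_ne_zero {i j k : ι} {s r : ℝ} (hs : 0 < s) (hr : 0 < r) (h1 : p s i k ≠ 0)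
    (h2 : p r k j ≠ 0) : ∃ q, 0 < q ∧ p q k k ≠ 0 := by
  by_contra! hk
  set η : ℝ≥0 := p s i k * p r k j
  have hηpos : 0 < η := pos_iff_ne_zero.2 (mul_ne_zero h1 h2)
  have hcont : ContinuousAt (fun v => p v i k * p (s + r - v) k j) s :=
    (hp.continuousOn_bridge_weight i j k (s + r)).continuousAt
      (Ioo_mem_nhds hs (by linarith))
  have hev : ∀ᶠ v in 𝓝 s, η / 2 < p v i k * p (s + r - v) k j ∧ v < s + r := by
    refine (hcont.eventually (lt_mem_nhds ?_)).and (gt_mem_nhds (by linarith))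
    simp only [add_sub_cancel_left]
    exact NNReal.half_lt_self hηpos.ne'
  obtain ⟨l, hl, hl'⟩ := exists_Ico_subset_of_mem_nhds hev ⟨s + 1, by linarith⟩
  obtain ⟨u, hu, hul, -⟩ := exists_seq_strictMono_tendsto' hl
  obtain ⟨N, hN⟩ := exists_nat_gt (p (s + r) i j / (η / 2))
  have hsum := hp.sum_le_of_diag_eq_zero hk hu (hs.trans (hul 0).1) i N (s + r) (by linarith)
    (fun m _ => (hl' ⟨(hul m).1.le, (hul m).2⟩).2) j
  have hge : ∑ m ∈ Finset.range N, η / 2 ≤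
      ∑ m ∈ Finset.range N, p (u m) i k * p (s + r - u m) k j :=
    Finset.sum_le_sum fun m _ => (hl' ⟨(hul m).1.le, (hul m).2⟩).1.le
  rw [Finset.sum_const, Finset.card_range, nsmul_eq_mul] at hge
  rw [div_lt_iff₀ (half_pos hηpos)] at hN
  exact absurd (hge.trans hsum) (not_le.2 hN)

/-- An entry of a matrix semigroup vanishes everywhere on `(0, ∞)` or nowhere. -/
theorem ne_zero_of_ne_zero {i j : ι} {t s : ℝ} (ht : 0 < t) (h : p t i j ≠ 0) (hs : 0 < s) :
    p s i j ≠ 0 := by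
  have ht2 : 0 < t / 2 := half_pos ht
  obtain ⟨k, h1, h2⟩ := hp.exists_ne_zero ht2 ht2 (by rwa [add_halves])
  obtain ⟨q, hq, hkk⟩ := hp.exists_diag_ne_zero ht2 ht2 h1 h2
  -- waiting in `k` for a time `s` between the two halves
  have h3 := hp.add_ne_zero (add_pos ht2 hs) ht2
    (hp.add_ne_zero ht2 hs h1 (hp.diag_ne_zero hq hkk hs)) h2
  exact hp.ne_zero_of_lt hs (by linarith) h3

end IsMatrixSemigroup

/-! ### Operators on sequence spaces -/

namespace NormedSequenceSpace

variable {E : NormedSequenceSpace}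

instance : IsOrderedAddMonoid E.Elem where
  add_le_add_left _ _ h z n := add_le_add_left (h n) (z.val n)

theorem nonneg_iff (x : E.Elem) : 0 ≤ x ↔ ∀ n, 0 ≤ x n := Iff.rfl

theorem unitVec_apply (k n : ℕ) : (E.unitVec k) n = if n = k then 1 else 0 := by
  change (Pi.single k 1 : ℕ → ℝ) n = _
  simp [Pi.single_apply]

theorem unitVec_nonneg (k : ℕ) : 0 ≤ E.unitVec k := by
  intro n
  change 0 ≤ (E.unitVec k) n
  rw [unitVec_apply]
  split_ifs <;> norm_num

theorem unitVec_ne_zero (k : ℕ) : E.unitVec k ≠ 0 := by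
  intro h
  have h1 := unitVec_apply (E := E) k k
  rw [h, if_pos rfl] at h1
  exact zero_ne_one h1

theorem abs_apply_mul_norm_le [HasSolidNorm E.Elem] (x : E.Elem) (j : ℕ) :
    |x j| * ‖E.unitVec j‖ ≤ ‖x‖ := by
  rw [← Real.norm_eq_abs, ← norm_smul]
  refine HasSolidNorm.solid fun n => ?_
  change |x j * (E.unitVec j) n| ≤ |x n|
  rw [unitVec_apply]
  split_ifs with h
  · simp [h]
  · simp

/-- The `j`-th component, as a continuous linear functional. -/
noncomputable def coord [HasSolidNorm E.Elem] (j : ℕ) : E.Elem →L[ℝ] ℝ :=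
  LinearMap.mkContinuous
    { toFun := fun x => x j
      map_add' := fun _ _ => rfl
      map_smul' := fun _ _ => rfl } ‖E.unitVec j‖⁻¹ fun x => by
    rw [inv_mul_eq_div, le_div_iff₀ (norm_pos_iff.2 (unitVec_ne_zero j))]
    exact abs_apply_mul_norm_le x j

theorem coord_apply [HasSolidNorm E.Elem] (j : ℕ) (x : E.Elem) : coord j x = x j := rfl

theorem sum_smul_unitVec_apply [HasSolidNorm E.Elem] (x : E.Elem) (n j : ℕ) :
    (∑ i ∈ Finset.range n, x i • E.unitVec i) j = if j < n then x j else 0 := by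
  rw [← coord_apply, map_sum]
  simp [map_smul, coord_apply, unitVec_apply]

/-- The unit vectors form a basis: order continuity turns the componentwise convergence of the
truncations, all bounded by `|x|`, into convergence in norm. -/
theorem tendsto_sum_smul_unitVec [HasSolidNorm E.Elem] (hE : E.OrderContinuousNorm) (x : E.Elem) :
    Tendsto (fun n => ∑ i ∈ Finset.range n, x i • E.unitVec i) atTop (𝓝 x) := by
  refine hE _ x ⟨⟨-|x|, |x|, fun n => ⟨fun j => ?_, fun j => ?_⟩⟩, fun j => ?_⟩
  · change -|x j| ≤ (∑ i ∈ Finset.range n, x i • E.unitVec i : E.Elem) j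
    rw [sum_smul_unitVec_apply]
    split_ifs
    exacts [neg_abs_le _, neg_nonpos.2 (abs_nonneg _)]
  · change (∑ i ∈ Finset.range n, x i • E.unitVec i : E.Elem) j ≤ |x j|
    rw [sum_smul_unitVec_apply]
    split_ifs
    exacts [le_abs_self _, abs_nonneg _]
  · refine tendsto_const_nhds.congr' ?_
    filter_upwards [eventually_gt_atTop j] with n hn
    rw [sum_smul_unitVec_apply, if_pos hn]

theorem separableSpace [HasSolidNorm E.Elem] (hE : E.OrderContinuousNorm) :
    TopologicalSpace.SeparableSpace E.Elem := by
  rw [← TopologicalSpace.isSeparable_univ_iff]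
  have h1 : TopologicalSpace.IsSeparable (Set.range E.unitVec) :=
    (Set.countable_range _).isSeparable
  refine (h1.span (R := ℝ)).closure.mono fun x _ => ?_
  refine mem_closure_of_tendsto (tendsto_sum_smul_unitVec hE x) (Eventually.of_forall fun n => ?_)
  exact Submodule.sum_mem _ fun i _ =>
    Submodule.smul_mem _ _ (Submodule.subset_span (Set.mem_range_self i))

/-- A positive operator on a Banach lattice is bounded. Otherwise there are `y n ≥ 0` with summable
norms and `‖T (y n)‖` unbounded, although `T (y n) ≤ T (∑' n, y n)`. -/
theorem exists_continuousLinearMap_of_nonneg [HasSolidNorm E.Elem] [CompleteSpace E.Elem]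
    (T : E.Elem →ₗ[ℝ] E.Elem) (hT : ∀ x, 0 ≤ x → 0 ≤ T x) :
    ∃ S : E.Elem →L[ℝ] E.Elem, ∀ x, S x = T x := by
  have hmono : ∀ x y, x ≤ y → T x ≤ T y := fun x y hxy => by
    have := hT (y - x) (sub_nonneg.2 hxy)
    rwa [map_sub, sub_nonneg] at this
  have hnorm : ∀ x y : E.Elem, 0 ≤ x → x ≤ y → ‖x‖ ≤ ‖y‖ := fun x y hx hxy =>
    HasSolidNorm.solid (by rwa [abs_of_nonneg hx, abs_of_nonneg (hx.trans hxy)])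
  obtain ⟨C, hC⟩ : ∃ C : ℝ, ∀ x, 0 ≤ x → ‖T x‖ ≤ C * ‖x‖ := by
    by_contra! hunb
    choose x hx0 hx using fun n : ℕ => hunb ((2 : ℝ) ^ n * 2 ^ n)
    have hxpos : ∀ n, 0 < ‖x n‖ := fun n => by
      refine norm_pos_iff.2 fun h => ?_
      have := hx n
      simp [h] at this
    let y : ℕ → E.Elem := fun n => ((2 : ℝ) ^ n * ‖x n‖)⁻¹ • x n
    have hcpos : ∀ n, 0 < (2 : ℝ) ^ n * ‖x n‖ := fun n => mul_pos (by positivity) (hxpos n)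
    have hy0 : ∀ n, 0 ≤ y n := fun n j =>
      mul_nonneg (inv_nonneg.2 (hcpos n).le) (hx0 n j)
    have hynorm : ∀ n, ‖y n‖ = (1 / 2 : ℝ) ^ n := fun n => by
      have := (hxpos n).ne'
      rw [norm_smul, norm_inv, Real.norm_of_nonneg (hcpos n).le, mul_inv, mul_assoc,
        inv_mul_cancel₀ this, mul_one, one_div, inv_pow]
    have hsum : Summable y := by
      refine Summable.of_norm ?_
      simp_rw [hynorm]
      exact summable_geometric_two
    have hTy : ∀ n, (2 : ℝ) ^ n ≤ ‖T (∑' n, y n)‖ := fun n => by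
      have h1 : y n ≤ ∑' n, y n := hsum.le_tsum n fun m _ => hy0 m
      refine le_trans ?_ (hnorm _ _ (hT _ (hy0 n)) (hmono _ _ h1))
      rw [map_smul, norm_smul, norm_inv, Real.norm_of_nonneg (hcpos n).le, inv_mul_eq_div,
        le_div_iff₀ (hcpos n), ← mul_assoc]
      exact (hx n).le
    obtain ⟨n, hn⟩ := pow_unbounded_of_one_lt ‖T (∑' n, y n)‖ (one_lt_two (α := ℝ))
    exact absurd (hTy n) (not_le.2 hn)
  refine ⟨T.mkContinuous C fun x => ?_, fun x => rfl⟩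
  have habs : |T x| ≤ |T (|x|)| := by
    rw [abs_of_nonneg (hT _ (abs_nonneg x)), abs_le', ← map_neg]
    exact ⟨hmono _ _ (le_abs_self x), hmono _ _ (neg_le_abs x)⟩
  calc ‖T x‖ ≤ ‖T (|x|)‖ := HasSolidNorm.solid habs
    _ ≤ C * ‖|x|‖ := hC _ (abs_nonneg x)
    _ = C * ‖x‖ := by rw [norm_abs_eq_norm]

theorem tendsto_sum_mul_apply [HasSolidNorm E.Elem] (hE : E.OrderContinuousNorm)
    (S : E.Elem →L[ℝ] E.Elem) (x : E.Elem) (j : ℕ) :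
    Tendsto (fun n => ∑ i ∈ Finset.range n, x i * (S (E.unitVec i)) j) atTop (𝓝 ((S x) j)) := by
  have h := (((coord j).comp S).continuous.tendsto x).comp (tendsto_sum_smul_unitVec hE x)
  refine h.congr fun n => ?_
  rw [Function.comp_apply, map_sum]
  refine Finset.sum_congr rfl fun i _ => ?_
  rw [map_smul, ContinuousLinearMap.comp_apply, coord_apply, smul_eq_mul]

theorem aestronglyMeasurable_apply [HasSolidNorm E.Elem] (hE : E.OrderContinuousNorm)
    {μ : Measure ℝ} {S : ℝ → E.Elem →L[ℝ] E.Elem}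
    (hS : ∀ i j, AEMeasurable (fun t => (S t (E.unitVec i)) j) μ) (x : E.Elem) :
    AEStronglyMeasurable (fun t => S t x) μ := by
  have hcoord : ∀ j, AEMeasurable (fun t => (S t x) j) μ := fun j =>
    aemeasurable_of_tendsto_metrizable_ae atTop
      (f := fun n t => ∑ i ∈ Finset.range n, x i * (S t (E.unitVec i)) j)
      (fun n => Finset.aemeasurable_fun_sum _ fun i _ => (hS i j).const_mul _)
      (Eventually.of_forall fun t => tendsto_sum_mul_apply hE (S t) x j)
  refine aestronglyMeasurable_of_tendsto_ae atTop
    (f := fun n t => ∑ i ∈ Finset.range n, (S t x) i • E.unitVec i) (fun n => ?_)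
    (Eventually.of_forall fun t => tendsto_sum_smul_unitVec hE (S t x))
  exact Finset.aestronglyMeasurable_fun_sum _ fun i _ =>
    (hcoord i).aestronglyMeasurable.smul_const _

end NormedSequenceSpace

/-! ### Continuity and the zero-one dichotomy -/

theorem corollary3p3 (E : NormedSequenceSpace) [HasSolidNorm E.Elem] [CompleteSpace E.Elem]
    (hE : E.OrderContinuousNorm)
    (T : ℝ → E.Elem →ₗ[ℝ] E.Elem) (hT : NormedSequenceSpace.IsPositiveSemigroup T)
    (hmeas : ∀ i j : ℕ,
      AEMeasurable (fun t : ℝ => (T t (E.unitVec i)) j) (volume.restrict (Set.Ioi (0 : ℝ)))) :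
    (∀ x : E.Elem, ContinuousOn (fun t : ℝ => T t x) (Set.Ioi (0 : ℝ))) ∧
    (∀ i j : ℕ, (∀ t : ℝ, 0 < t → 0 < (T t (E.unitVec i)) j) ∨
      (∀ t : ℝ, 0 < t → (T t (E.unitVec i)) j = 0)) := by
  have := NormedSequenceSpace.separableSpace hE
  -- positivity, and hence boundedness, of `T t` is known only for `t > 0`; elsewhere `S t = 0`
  have hbdd : ∀ t, ∃ S : E.Elem →L[ℝ] E.Elem, 0 < t → ∀ x, S x = T t x := fun t => by
    by_cases ht : 0 < t
    · obtain ⟨S, hS⟩ :=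
        NormedSequenceSpace.exists_continuousLinearMap_of_nonneg (T t) (hT.nonneg t ht)
      exact ⟨S, fun _ => hS⟩
    · exact ⟨0, fun h => absurd h ht⟩
  choose S hS using hbdd
  have hadd : ∀ t s, 0 < t → 0 < s → S (t + s) = (S t).comp (S s) := fun t s ht hs => by
    ext1 x
    rw [ContinuousLinearMap.comp_apply, hS _ (add_pos ht hs), hS t ht, hS s hs,
      hT.map_add t s ht hs, LinearMap.comp_apply]
  have hSmeas : ∀ i j, AEMeasurable (fun t => (S t (E.unitVec i)) j)
      (volume.restrict (Set.Ioi (0 : ℝ))) := fun i j => by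
    refine (hmeas i j).congr ?_
    filter_upwards [ae_restrict_mem measurableSet_Ioi] with t ht
    rw [hS t ht]
  have hcont : ∀ x : E.Elem, ContinuousOn (fun t => S t x) (Set.Ioi 0) :=
    continuousOn_of_aestronglyMeasurable_semigroup hadd
      (NormedSequenceSpace.aestronglyMeasurable_apply hE hSmeas)
  refine ⟨fun x => (hcont x).congr fun t ht => (hS t ht x).symm, ?_⟩
  have hnonneg : ∀ t, 0 < t → ∀ i j, 0 ≤ (S t (E.unitVec i)) j := fun t ht i => by
    rw [← NormedSequenceSpace.nonneg_iff, hS t ht]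
    exact hT.nonneg t ht _ (NormedSequenceSpace.unitVec_nonneg i)
  let p : ℝ → ℕ → ℕ → ℝ≥0 := fun t i j => ((S t (E.unitVec i)) j).toNNReal
  have hp : IsMatrixSemigroup p := by
    refine ⟨fun t s ht hs i j => ?_, fun i j => ?_⟩
    · have hnn : ∀ k, 0 ≤ (S t (E.unitVec i)) k * (S s (E.unitVec k)) j := fun k =>
        mul_nonneg (hnonneg t ht i k) (hnonneg s hs k j)
      have hsum := (hasSum_iff_tendsto_nat_of_nonneg hnn _).2
        (NormedSequenceSpace.tendsto_sum_mul_apply hE (S s) (S t (E.unitVec i)) j)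
      rw [← ContinuousLinearMap.comp_apply, ← hadd s t hs ht, add_comm s t] at hsum
      change ENNReal.ofReal ((S (t + s) (E.unitVec i)) j) = _
      rw [← hsum.tsum_eq, ENNReal.ofReal_tsum_of_nonneg hnn hsum.summable]
      exact tsum_congr fun k => ENNReal.ofReal_mul (hnonneg t ht i k)
    · exact continuous_real_toNNReal.comp_continuousOn
        ((NormedSequenceSpace.coord j).continuous.comp_continuousOn (hcont (E.unitVec i)))
  intro i j
  have hpos : ∀ t, 0 < t → (p t i j ≠ 0 ↔ 0 < (T t (E.unitVec i)) j) := fun t ht => by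
    rw [← pos_iff_ne_zero, Real.toNNReal_pos, hS t ht]
  by_cases h : ∃ t, 0 < t ∧ p t i j ≠ 0
  · obtain ⟨t, ht, h⟩ := h
    exact Or.inl fun s hs => (hpos s hs).1 (hp.ne_zero_of_ne_zero ht h hs)
  · push Not at h
    refine Or.inr fun t ht => ?_
    have h1 : (S t (E.unitVec i)) j ≤ 0 := Real.toNNReal_eq_zero.1 (h t ht)
    rw [← hS t ht]
    exact h1.antisymm (hnonneg t ht i j)
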